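/- Piecewise constant bandit: fix a budget $T\in\mathbb{N}$ and a tolerance $\eta>0$. In each round $t=1,\dots,T$ the learner plays an action $x_t\in[0,1]$, which may depend on the past observations and on internal randomization, and observes $y_t=f(x_t)+\epsilon_t$, where $f(x)=\mu_1\mathbb{I}\{x\le x^*\}+\mu_2\mathbb{I}\{x>x^*\}$ with $\mu_1\ne\mu_2$ in $\mathbb{R}$ and change point $x^*\in[0,1)$, and the $\epsilon_t$ are i.i.d. noise variables. After $T$ rounds the learner returns an estimate $\hat x_T$ of the change point. Let $\Pi$ be the set of all such policies with budget $T$. For $\Delta>0$ and $\sigma>0$ let $\bar V$ be the set of all environments $v$ (with arbitrary $x^*_v\in[0,1)$ and arbitrary $\mu_1,\mu_2$) with $|\mu_1-\mu_2|=\Delta$ and Gaussian noise of mean $0$ and variance $\sigma^2$. Let $\mathbb{P}_{\pi,v}$ be the law of the interaction of policy $\pi$ with environment $v$, and let $F_{T,v,\eta}=\{|\hat x_T-x^*_v|\ge\eta\}$ be the failure event. **Theorem.** If $$T<T_1:=\frac{\sigma^2}{\Delta^2}\left(1.59\log\left\lfloor\tfrac{1}{2\eta}\right\rfloor-2\log 2\right),$$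 then $$\inf_{\pi\in\Pi}\ \sup_{v\in\bar V}\ \mathbb{P}_{\pi,v}(F_{T,v,\eta})\ \ge\ \exp\left(-\frac{\Delta^2T+2\sigma^2\log 2}{\sigma^2\log\left\lfloor\frac{1}{2\eta}\right\rfloor}\right).$$ (Here $\log\lfloor 1/(2\eta)\rfloor$ is read as $0$ when $\lfloor 1/(2\eta)\rfloor=0$; the assumption $T<T_1$ in fact forces $\lfloor 1/(2\eta)\rfloor\ge 3$.) -/

import Mathlib

open MeasureTheory ProbabilityTheory
open scoped NNReal ENNReal

noncomputable section

namespace PCBandit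

/-- The action space `[0, 1]`. -/
abbrev Action : Type := Set.Icc (0 : ℝ) 1

/-- The observations of the first `t` rounds: the pairs (action played, reward observed). -/
abbrev History (t : ℕ) : Type := Fin t → Action × ℝ

/-- An environment of the piecewise constant bandit problem: a mean reward function with exactly
one change point in `[0, 1)`, and the common law of the i.i.d. noise variables. -/
structure Environment where
  changePoint : ℝ
  changePoint_mem : changePoint ∈ Set.Ico (0 : ℝ) 1
  μ₁ : ℝ
  μ₂ : ℝ
  μ_ne : μ₁ ≠ μ₂
  noise : Measure ℝ
  noise_prob : IsProbabilityMeasure noise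

namespace Environment

instance (v : Environment) : IsProbabilityMeasure v.noise := v.noise_prob

/-- The mean reward function `f = μ₁ 𝟙{x ≤ x*} + μ₂ 𝟙{x > x*}`. -/
def meanReward (v : Environment) (x : Action) : ℝ :=
  if (x : ℝ) ≤ v.changePoint then v.μ₁ else v.μ₂

/-- The change in mean reward. -/
def gap (v : Environment) : ℝ := |v.μ₁ - v.μ₂|

lemma measurable_meanReward (v : Environment) : Measurable v.meanReward :=
  Measurable.ite (measurableSet_le measurable_subtype_coe measurable_const)
    measurable_const measurable_const

/-- The law of the reward `f x + ε` observed on playing `x`, as a Markov kernel. -/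
def reward (v : Environment) : Kernel Action ℝ where
  toFun x := v.noise.map (fun e => v.meanReward x + e)
  measurable' := by
    refine Measure.measurable_of_measurable_coe _ fun s hs => ?_
    have h : ∀ x : Action, v.noise.map (fun e => v.meanReward x + e) s
        = v.noise (Prod.mk x ⁻¹' {p : Action × ℝ | v.meanReward p.1 + p.2 ∈ s}) := fun x =>
      Measure.map_apply (measurable_const.add measurable_id) hs
    simp only [h]
    exact measurable_measure_prodMk_left
      (((v.measurable_meanReward.comp measurable_fst).add measurable_snd) hs)

lemma reward_apply (v : Environment) (x : Action) :
    v.reward x = v.noise.map (fun e => v.meanReward x + e) := rfl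

instance (v : Environment) : IsMarkovKernel v.reward :=
  ⟨fun x => by
    rw [reward_apply]
    exact Measure.isProbabilityMeasure_map (measurable_const.add measurable_id).aemeasurable⟩

end Environment

/-- `V(Δ, σ)`: environments with change in mean `Δ` and centred `σ²`-sub-Gaussian noise. -/
def subGaussianEnvs (Δ : ℝ) (σ : ℝ≥0) : Set Environment :=
  {v | v.gap = Δ ∧ ∫ e, e ∂v.noise = 0 ∧ HasSubgaussianMGF id (σ ^ 2) v.noise}

/-- The environments of `V(Δ, σ)` whose noise is Gaussian with mean zero and variance `σ²`. -/
def gaussianEnvs (Δ : ℝ) (σ : ℝ≥0) : Set Environment :=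
  {v ∈ subGaussianEnvs Δ σ | v.noise = gaussianReal 0 (σ ^ 2)}

/-- A (possibly randomized) policy with budget `T`. After the first `t` rounds the next action is
drawn from `action t` given the history; only the rounds `t < T` matter. After `T` rounds the
estimate of the change point is drawn from `estimate` given the whole history. -/
structure Policy (T : ℕ) where
  action : (t : ℕ) → Kernel (History t) Action
  action_markov : ∀ t, IsMarkovKernel (action t)
  estimate : Kernel (History T) ℝ
  estimate_markov : IsMarkovKernel estimate

namespace Policy

variable {T : ℕ}

instance (π : Policy T) (t : ℕ) : IsMarkovKernel (π.action t) := π.action_markov t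

instance (π : Policy T) : IsMarkovKernel π.estimate := π.estimate_markov

/-- Given the history of the first `t` rounds, the joint law of the next action and reward. -/
def step (π : Policy T) (v : Environment) (t : ℕ) : Kernel (History t) (Action × ℝ) :=
  π.action t ⊗ₖ Kernel.prodMkLeft (History t) v.reward

instance (π : Policy T) (v : Environment) (t : ℕ) : IsMarkovKernel (π.step v t) := by
  unfold step; infer_instance

end Policy

/-- Append one observation to a history. -/
def History.append {t : ℕ} (p : History t × (Action × ℝ)) : History (t + 1) :=
  Fin.snoc (α := fun _ => Action × ℝ) p.1 p.2

lemma History.measurable_append {t : ℕ} : Measurable (History.append (t := t)) := by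
  refine measurable_pi_lambda _ fun i => ?_
  refine Fin.lastCases ?_ (fun j => ?_) i
  · simpa [History.append] using measurable_snd
  · simpa [History.append, Function.comp_def] using
      (measurable_pi_apply (X := fun _ : Fin t => Action × ℝ) j).comp
        (measurable_fst (β := Action × ℝ))

namespace Policy

variable {T : ℕ}

/-- The law of the history of the first `t` rounds of the interaction of `π` with `v`. -/
def historyLaw (π : Policy T) (v : Environment) : (t : ℕ) → Measure (History t)
  | 0 => Measure.dirac Fin.elim0
  | t + 1 => (historyLaw π v t ⊗ₘ π.step v t).map History.append

instance (π : Policy T) (v : Environment) (t : ℕ) : IsProbabilityMeasure (π.historyLaw v t) := by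
  induction t with
  | zero => unfold historyLaw; infer_instance
  | succ t ih =>
    unfold historyLaw
    exact Measure.isProbabilityMeasure_map History.measurable_append.aemeasurable

/-- The joint law `ℙ_{π,v}` of the history of all `T` rounds and the estimate. -/
def law (π : Policy T) (v : Environment) : Measure (History T × ℝ) :=
  π.historyLaw v T ⊗ₘ π.estimate

instance (π : Policy T) (v : Environment) : IsProbabilityMeasure (π.law v) := by
  unfold law; infer_instance

/-- The probability, under `ℙ_{π,v}`, of the failure event that the estimate is at distance at
least `η` from the change point of `v`. -/
def failureProb (π : Policy T) (v : Environment) (η : ℝ) : ℝ≥0∞ :=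
  π.law v {p | η ≤ |p.2 - v.changePoint|}

end Policy

/-- The budget `T₁ = (σ² / Δ²) (1.59 log ⌊1 / (2η)⌋ - 2 log 2)` below which budgets are small. -/
def smallBudgetThreshold (Δ σ η : ℝ) : ℝ :=
  σ ^ 2 / Δ ^ 2 * (1.59 * Real.log (⌊1 / (2 * η)⌋₊ : ℝ) - 2 * Real.log 2)

end PCBandit

end

/-! Put `K = ⌊1/(2η)⌋` change points at `2ηj`, `j < K`, with common means `Δ` and `0`. The success
events `|x̂ - 2ηj| < η` are disjoint, so a Fano argument (`EntropyBound.exists_real_mul_log_le`)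
yields a `j` whose success probability times `log K` is at most `D + log 2`, where `D` bounds the
relative entropy to the environment with `j = 0`. Each round contributes at most `Δ²/(2σ²)`, since
the policy's own kernels are shared; the chain rule (`EntropyBound.compProd`) gives `D = TΔ²/(2σ²)`.
Success thus has probability at most `z/2`, with `z` the exponent of the theorem, and `T < T₁` says
`z < 1.59`, where `1 - z/2 ≥ exp (-z)`. -/

namespace PCBandit

/-! ### Relative entropy through bounded test functions. -/

section EntropyBound

variable {α β : Type*} [MeasurableSpace α] [MeasurableSpace β]

/-- The relative entropy of `P` with respect to `Q` is at most `D`, in the variational form of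
Donsker and Varadhan. -/
def EntropyBound (P Q : Measure α) (D : ℝ) : Prop :=
  ∀ g : α → ℝ, Measurable g → ∀ C : ℝ, (∀ x, |g x| ≤ C) →
    ∫ x, g x ∂P ≤ D + Real.log (∫ x, Real.exp (g x) ∂Q)

lemma integrable_of_abs_le {μ : Measure α} [IsFiniteMeasure μ] {g : α → ℝ} (hg : Measurable g)
    {C : ℝ} (hC : ∀ x, |g x| ≤ C) : Integrable g μ :=
  Integrable.of_bound hg.aestronglyMeasurable C (ae_of_all _ hC)

lemma integrable_exp_of_abs_le {μ : Measure α} [IsFiniteMeasure μ] {g : α → ℝ} (hg : Measurable g)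
    {C : ℝ} (hC : ∀ x, |g x| ≤ C) : Integrable (fun x => Real.exp (g x)) μ :=
  integrable_of_abs_le hg.exp (C := Real.exp C) fun x => by
    rw [abs_of_pos (Real.exp_pos _)]
    exact Real.exp_le_exp.2 ((le_abs_self _).trans (hC x))

lemma integral_le_log_integral_exp {μ : Measure α} [IsProbabilityMeasure μ] {g : α → ℝ}
    (hg : Integrable g μ) (he : Integrable (fun x => Real.exp (g x)) μ) :
    ∫ x, g x ∂μ ≤ Real.log (∫ x, Real.exp (g x) ∂μ) := by
  have h := convexOn_exp.map_integral_le Real.continuous_exp.continuousOn isClosed_univ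
    (ae_of_all μ fun _ => Set.mem_univ _) hg he
  exact (Real.le_log_iff_exp_le ((Real.exp_pos _).trans_le h)).2 h

lemma EntropyBound.refl (P : Measure α) [IsProbabilityMeasure P] : EntropyBound P P 0 :=
  fun g hg C hC => by
    rw [zero_add]
    exact integral_le_log_integral_exp (integrable_of_abs_le hg hC)
      (integrable_exp_of_abs_le hg hC)

lemma EntropyBound.map {P Q : Measure α} {D : ℝ} (h : EntropyBound P Q D) {f : α → β}
    (hf : Measurable f) : EntropyBound (P.map f) (Q.map f) D := fun g hg C hC => by
  rw [integral_map hf.aemeasurable hg.aestronglyMeasurable,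
    integral_map hf.aemeasurable hg.exp.aestronglyMeasurable]
  exact h _ (hg.comp hf) C fun x => hC _

lemma abs_log_integral_exp_le {μ : Measure α} [IsProbabilityMeasure μ] {g : α → ℝ}
    (hg : Measurable g) {C : ℝ} (hC : ∀ x, |g x| ≤ C) :
    |Real.log (∫ x, Real.exp (g x) ∂μ)| ≤ C := by
  have hi := integrable_exp_of_abs_le (μ := μ) hg hC
  have h1 : Real.exp (-C) ≤ ∫ x, Real.exp (g x) ∂μ := by
    simpa using integral_mono (integrable_const (Real.exp (-C))) hi
      fun x => Real.exp_le_exp.2 (abs_le.1 (hC x)).1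
  have h2 : ∫ x, Real.exp (g x) ∂μ ≤ Real.exp C := by
    simpa using integral_mono hi (integrable_const (Real.exp C))
      fun x => Real.exp_le_exp.2 (abs_le.1 (hC x)).2
  have h0 := (Real.exp_pos _).trans_le h1
  exact abs_le.2 ⟨(Real.le_log_iff_exp_le h0).2 h1, (Real.log_le_iff_le_exp h0).2 h2⟩

/-- Chain rule. Bounding each section `g (a, ·)` leaves its log-partition function `G a`, which is
again bounded by `C` and so is a legitimate test function for the first marginal. -/
lemma EntropyBound.compProd {μ ν : Measure α} [IsProbabilityMeasure μ] [IsProbabilityMeasure ν]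
    {κ η : Kernel α β} [IsMarkovKernel κ] [IsMarkovKernel η] {D D' : ℝ}
    (h : EntropyBound μ ν D) (h' : ∀ a, EntropyBound (κ a) (η a) D') :
    EntropyBound (μ ⊗ₘ κ) (ν ⊗ₘ η) (D + D') := fun g hg C hC => by
  set G : α → ℝ := fun a => Real.log (∫ b, Real.exp (g (a, b)) ∂(η a)) with hG
  have hsec : ∀ a, Measurable fun b => g (a, b) := fun a => hg.comp measurable_prodMk_left
  have hGm : Measurable G :=
    (StronglyMeasurable.integral_kernel_prod_right'
      (κ := η) hg.exp.stronglyMeasurable).measurable.log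
  have hGC : ∀ a, |G a| ≤ C := fun a => abs_log_integral_exp_le (hsec a) fun b => hC _
  have hexp : ∀ a, Real.exp (G a) = ∫ b, Real.exp (g (a, b)) ∂(η a) := fun a =>
    Real.exp_log (integral_exp_pos (integrable_exp_of_abs_le (hsec a) fun b => hC _))
  have hgi : Integrable g (μ ⊗ₘ κ) := integrable_of_abs_le hg hC
  rw [Measure.integral_compProd hgi,
    Measure.integral_compProd (integrable_exp_of_abs_le hg hC)]
  have hinner : Integrable (fun a => ∫ b, g (a, b) ∂κ a) μ := by
    refine integrable_of_abs_le (StronglyMeasurable.integral_kernel_prod_right'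
      (κ := κ) hg.stronglyMeasurable).measurable (C := C) fun a => ?_
    simpa using norm_integral_le_of_norm_le_const (μ := κ a) (f := fun b => g (a, b))
      (ae_of_all _ fun b => hC (a, b))
  have hGi : Integrable G μ := integrable_of_abs_le hGm hGC
  calc ∫ a, ∫ b, g (a, b) ∂κ a ∂μ ≤ ∫ a, (D' + G a) ∂μ := by
        refine integral_mono hinner ((integrable_const _).add hGi) fun a => ?_
        exact h' a _ (hsec a) C fun b => hC _
    _ = D' + ∫ a, G a ∂μ := by
        rw [integral_add (integrable_const _) hGi]; simp
    _ ≤ D' + (D + Real.log (∫ a, Real.exp (G a) ∂ν)) := by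
        gcongr
        exact h G hGm C hGC
    _ = _ := by simp_rw [hexp]; ring

lemma EntropyBound.mono {P Q : Measure α} {D D' : ℝ} (h : EntropyBound P Q D) (hD : D ≤ D') :
    EntropyBound P Q D' := fun g hg C hC => (h g hg C hC).trans (by gcongr)

/-- Fano's inequality for disjoint events, with a reference measure. -/
lemma EntropyBound.exists_real_mul_log_le {K : ℕ} (hK : 0 < K) {P : Fin K → Measure α}
    [∀ j, IsProbabilityMeasure (P j)] {Q : Measure α} [IsProbabilityMeasure Q] {D : ℝ}
    (h : ∀ j, EntropyBound (P j) Q D) {S : Fin K → Set α} (hS : ∀ j, MeasurableSet (S j))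
    (hdisj : Pairwise (Function.onFun Disjoint S)) :
    ∃ j, (P j).real (S j) * Real.log K ≤ D + Real.log 2 := by
  have hK0 : (0 : ℝ) < K := by exact_mod_cast hK
  have hsum : ∑ j, Q.real (S j) ≤ 1 := by
    rw [← measureReal_biUnion_finset (fun i _ j _ hij => hdisj hij) fun j _ => hS j]
    exact measureReal_le_one
  -- Pigeonhole: `K` disjoint events cannot all have `Q`-mass above `1/K`.
  obtain ⟨j, hj⟩ : ∃ j, K * Q.real (S j) ≤ 1 := by
    by_contra! hcon
    have : Nonempty (Fin K) := ⟨⟨0, hK⟩⟩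
    have h1 := Finset.sum_lt_sum_of_nonempty Finset.univ_nonempty fun j _ => hcon j
    rw [← Finset.mul_sum] at h1
    simp only [Finset.sum_const, Finset.card_univ, Fintype.card_fin, nsmul_eq_mul, mul_one] at h1
    nlinarith
  refine ⟨j, ?_⟩
  -- Test function `log K` on `S j`, `0` elsewhere: its exponential has `Q`-integral `1 + (K - 1)
  -- Q(S j) ≤ 2`, the source of `log 2`.
  have hgm : Measurable ((S j).indicator fun _ => Real.log K) :=
    measurable_const.indicator (hS j)
  have hlog : 0 ≤ Real.log K := Real.log_natCast_nonneg K
  have hgC : ∀ x, |(S j).indicator (fun _ => Real.log K) x| ≤ Real.log K := fun x => by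
    by_cases hx : x ∈ S j <;> simp [hx, abs_of_nonneg hlog, hlog]
  have hmain := h j _ hgm _ hgC
  have hexp : ∀ x, Real.exp ((S j).indicator (fun _ => Real.log K) x)
      = 1 + (S j).indicator (fun _ => (K : ℝ) - 1) x := fun x => by
    by_cases hx : x ∈ S j <;> simp [hx, Real.exp_log hK0]
  simp_rw [hexp] at hmain
  rw [integral_add (integrable_const _) ((integrable_const _).indicator (hS j)),
    integral_indicator_const _ (hS j), integral_indicator_const _ (hS j)] at hmain
  simp only [integral_const, probReal_univ, smul_eq_mul, mul_one] at hmain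
  refine hmain.trans ?_
  have hq : 0 ≤ Q.real (S j) := measureReal_nonneg
  have hK1 : (1 : ℝ) ≤ K := by exact_mod_cast hK
  gcongr
  nlinarith

end EntropyBound

/-! ### Gaussian environments. -/

/-- `L` is the log-density of the second law relative to the first. Jensen for `g + L` under the
first law suffices, because `L` has mean `-(m - m')²/(2s)`. -/
lemma entropyBound_gaussianReal (m m' : ℝ) {s : ℝ≥0} (hs : s ≠ 0) :
    EntropyBound (gaussianReal m s) (gaussianReal m' s) ((m - m') ^ 2 / (2 * s)) :=
  fun g hg C hC => by
  have hs' : (s : ℝ) ≠ 0 := by exact_mod_cast hs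
  set L : ℝ → ℝ := fun x => (m' - m) / s * x + (m ^ 2 - m' ^ 2) / (2 * s) with hL
  have hpdf : ∀ x, gaussianPDFReal m' s x = gaussianPDFReal m s x * Real.exp (L x) := fun x => by
    rw [gaussianPDFReal, gaussianPDFReal, mul_assoc (√_)⁻¹, ← Real.exp_add]
    congr 2
    rw [hL]
    field_simp
    ring
  have hchange : ∫ x, Real.exp (g x) ∂(gaussianReal m' s)
      = ∫ x, Real.exp (g x + L x) ∂(gaussianReal m s) := by
    rw [integral_gaussianReal_eq_integral_smul hs, integral_gaussianReal_eq_integral_smul hs]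
    refine integral_congr_ae (ae_of_all _ fun x => ?_)
    simp only [smul_eq_mul]
    rw [hpdf, Real.exp_add (g x), mul_assoc, mul_comm (Real.exp (L x))]
  have hid : Integrable (fun x : ℝ => x) (gaussianReal m s) :=
    (memLp_id_gaussianReal 1).integrable le_rfl
  have hLi : Integrable L (gaussianReal m s) := (hid.const_mul _).add (integrable_const _)
  have hLint : ∫ x, L x ∂(gaussianReal m s) = -((m - m') ^ 2 / (2 * s)) := by
    rw [hL, integral_add (hid.const_mul _) (integrable_const _), integral_const_mul,
      integral_id_gaussianReal]
    simp only [integral_const, probReal_univ, smul_eq_mul, one_mul]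
    field_simp
    ring
  have hLe : Integrable (fun x => Real.exp (L x)) (gaussianReal m s) := by
    simp only [hL, Real.exp_add]
    exact (integrable_exp_mul_gaussianReal _).mul_const _
  have hgL : Integrable (fun x => Real.exp (g x + L x)) (gaussianReal m s) := by
    simp only [Real.exp_add]
    refine hLe.bdd_mul (c := Real.exp C) hg.exp.aestronglyMeasurable (ae_of_all _ fun x => ?_)
    rw [Real.norm_eq_abs, abs_of_pos (Real.exp_pos _)]
    exact Real.exp_le_exp.2 ((le_abs_self _).trans (hC x))
  have hgi : Integrable g (gaussianReal m s) := integrable_of_abs_le hg hC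
  have hJ := integral_le_log_integral_exp (hgi.add hLi) hgL
  simp only [Pi.add_apply] at hJ
  rw [integral_add hgi hLi, hLint] at hJ
  rw [hchange]
  linarith

lemma hasSubgaussianMGF_id_gaussianReal (s : ℝ≥0) : HasSubgaussianMGF id s (gaussianReal 0 s) where
  integrable_exp_mul t := integrable_exp_mul_gaussianReal t
  mgf_le t := by simp [mgf_id_gaussianReal]

/-- The environment with change point `x`, means `Δ` and `0`, and Gaussian noise. -/
noncomputable def gaussianEnv (Δ : ℝ) (hΔ : Δ ≠ 0) (σ : ℝ≥0) (x : ℝ) (hx : x ∈ Set.Ico (0 : ℝ) 1) :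
    Environment where
  changePoint := x
  changePoint_mem := hx
  μ₁ := Δ
  μ₂ := 0
  μ_ne := hΔ
  noise := gaussianReal 0 (σ ^ 2)
  noise_prob := inferInstance

lemma gaussianEnv_mem {Δ : ℝ} (hΔ : 0 < Δ) (σ : ℝ≥0) (x : ℝ) (hx : x ∈ Set.Ico (0 : ℝ) 1) :
    gaussianEnv Δ hΔ.ne' σ x hx ∈ gaussianEnvs Δ σ := by
  refine ⟨⟨?_, ?_, hasSubgaussianMGF_id_gaussianReal _⟩, rfl⟩
  · simp [Environment.gap, gaussianEnv, abs_of_pos hΔ]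
  · simp [gaussianEnv]

lemma entropyBound_reward {Δ : ℝ} (hΔ : Δ ≠ 0) {σ : ℝ≥0} (hσ : σ ≠ 0) {x x' : ℝ}
    (hx : x ∈ Set.Ico (0 : ℝ) 1) (hx' : x' ∈ Set.Ico (0 : ℝ) 1) (a : Action) :
    EntropyBound ((gaussianEnv Δ hΔ σ x hx).reward a) ((gaussianEnv Δ hΔ σ x' hx').reward a)
      (Δ ^ 2 / (2 * (σ : ℝ) ^ 2)) := by
  rw [Environment.reward_apply, Environment.reward_apply]
  change EntropyBound ((gaussianReal 0 (σ ^ 2)).map _) ((gaussianReal 0 (σ ^ 2)).map _) _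
  rw [gaussianReal_map_const_add, gaussianReal_map_const_add, zero_add, zero_add]
  refine (entropyBound_gaussianReal _ _ (pow_ne_zero 2 hσ)).mono ?_
  push_cast
  refine div_le_div_of_nonneg_right ?_ (by positivity)
  have hmean : ∀ y hy, (gaussianEnv Δ hΔ σ y hy).meanReward a = Δ ∨
      (gaussianEnv Δ hΔ σ y hy).meanReward a = 0 := fun y hy => ite_eq_or_eq _ _ _
  rcases hmean x hx with h | h <;> rcases hmean x' hx' with h' | h' <;>
    simp [h, h', sq_nonneg]

/-! ### Entropy accumulated over the interaction. -/

namespace Policy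

variable {T : ℕ}

lemma step_apply (π : Policy T) (v : Environment) (t : ℕ) (h : History t) :
    π.step v t h = π.action t h ⊗ₘ v.reward := by
  rw [step, Kernel.compProd_apply_eq_compProd_sectR, Kernel.sectR_prodMkLeft]

lemma entropyBound_historyLaw (π : Policy T) {v v' : Environment} {D : ℝ}
    (hD : ∀ a, EntropyBound (v.reward a) (v'.reward a) D) (t : ℕ) :
    EntropyBound (π.historyLaw v t) (π.historyLaw v' t) (t * D) := by
  induction t with
  | zero =>
    rw [Nat.cast_zero, zero_mul]
    exact EntropyBound.refl _
  | succ t ih =>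
    have hstep : ∀ h, EntropyBound (π.step v t h) (π.step v' t h) D := fun h => by
      rw [step_apply, step_apply]
      simpa using (EntropyBound.refl (π.action t h)).compProd hD
    have := (ih.compProd hstep).map History.measurable_append
    rw [Nat.cast_succ, add_one_mul]
    exact this

lemma entropyBound_law (π : Policy T) {v v' : Environment} {D : ℝ}
    (hD : ∀ a, EntropyBound (v.reward a) (v'.reward a) D) :
    EntropyBound (π.law v) (π.law v') (T * D) := by
  have := (π.entropyBound_historyLaw hD T).compProd fun h => EntropyBound.refl (π.estimate h)
  rwa [add_zero] at this

end Policy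

/-- By convexity it suffices to check the endpoints `0` and `1.59`; the latter lies just below the
positive root of `exp (-z) = 1 - z/2`. -/
lemma exp_neg_le_one_sub_half {z : ℝ} (h0 : 0 ≤ z) (h1 : z ≤ 1.59) :
    Real.exp (-z) ≤ 1 - z / 2 := by
  have hend : Real.exp (-1.59) ≤ 1 - 1.59 / 2 := by
    rw [Real.exp_neg, inv_le_comm₀ (Real.exp_pos _) (by norm_num)]
    refine le_trans ?_ (Real.sum_le_exp_of_nonneg (by norm_num) 9)
    norm_num [Finset.sum_range_succ, Nat.factorial]
  obtain ⟨-, hconv⟩ := convexOn_exp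
  have hc := hconv (Set.mem_univ (-1.59 : ℝ)) (Set.mem_univ (0 : ℝ))
    (a := z / 1.59) (b := 1 - z / 1.59) (show 0 ≤ z / 1.59 by positivity)
    (sub_nonneg.2 ((div_le_one (by norm_num)).2 h1)) (by ring)
  simp only [smul_eq_mul, Real.exp_zero, mul_zero, add_zero, mul_one] at hc
  have he : z / 1.59 * -1.59 = -z := by ring
  rw [he] at hc
  have := mul_le_mul_of_nonneg_left hend (show 0 ≤ z / 1.59 by positivity)
  linarith [show z / 1.59 * (1 - 1.59 / 2) + (1 - z / 1.59) = 1 - z / 2 by ring]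

end PCBandit

open PCBandit in
theorem theorem4 (Δ : ℝ) (hΔ : 0 < Δ) (σ : NNReal) (hσ : 0 < σ) (η : ℝ) (hη : 0 < η)
    (T : ℕ) (hT : (T : ℝ) < PCBandit.smallBudgetThreshold Δ (σ : ℝ) η) :
    ENNReal.ofReal (Real.exp
        (-((Δ ^ 2 * (T : ℝ) + 2 * (σ : ℝ) ^ 2 * Real.log 2) /
            ((σ : ℝ) ^ 2 * Real.log (⌊1 / (2 * η)⌋₊ : ℝ)))))
      ≤ ⨅ π : PCBandit.Policy T, ⨆ v ∈ PCBandit.gaussianEnvs Δ σ, π.failureProb v η := by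
  refine le_iInf fun π => ?_
  have hσ' : (0 : ℝ) < σ := by exact_mod_cast hσ
  set K : ℕ := ⌊1 / (2 * η)⌋₊ with hKdef
  have hlog2 : 0 < Real.log 2 := Real.log_pos one_lt_two
  rw [smallBudgetThreshold, ← hKdef, div_mul_eq_mul_div, lt_div_iff₀ (by positivity)] at hT
  have hnum : 0 < Δ ^ 2 * (T : ℝ) + 2 * (σ : ℝ) ^ 2 * Real.log 2 := by positivity
  -- Otherwise `T₁` would be negative. This also rules out `K = 0`, where `Real.log 0 = 0`.
  have hlogK : 0 < Real.log K := by
    by_contra! hcon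
    nlinarith [mul_nonneg (sq_nonneg (σ : ℝ)) (neg_nonneg.2 hcon)]
  have hK : 0 < K := by
    rcases Nat.eq_zero_or_pos K with h | h
    · simp [h] at hlogK
    · exact h
  set z := (Δ ^ 2 * (T : ℝ) + 2 * (σ : ℝ) ^ 2 * Real.log 2) / ((σ : ℝ) ^ 2 * Real.log K) with hz
  have hz0 : 0 ≤ z := by positivity
  have hz1 : z ≤ 1.59 := by
    rw [hz, div_le_iff₀ (by positivity)]
    linarith
  have hKη : (K : ℝ) * (2 * η) ≤ 1 := by
    rw [← le_div_iff₀ (by positivity)]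
    exact Nat.floor_le (by positivity)
  have hx : ∀ j : Fin K, 2 * η * (j : ℕ) ∈ Set.Ico (0 : ℝ) 1 := fun j => by
    refine ⟨by positivity, lt_of_lt_of_le ?_ hKη⟩
    rw [mul_comm]
    gcongr
    exact j.2
  let v : Fin K → Environment := fun j => gaussianEnv Δ hΔ.ne' σ _ (hx j)
  let S : Fin K → Set (History T × ℝ) := fun j => {p | |p.2 - (v j).changePoint| < η}
  have hS : ∀ j, MeasurableSet (S j) := fun j =>
    measurableSet_lt (measurable_snd.sub measurable_const).abs measurable_const
  -- Distinct centres are at least `2η` apart and the intervals of radius `η` are open.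
  have hdisj : Pairwise (Function.onFun Disjoint S) := fun i j hij => by
    refine Set.disjoint_left.2 fun p hi hj => ?_
    have hi' : |p.2 - 2 * η * (i : ℕ)| < η := hi
    have hj' : |p.2 - 2 * η * (j : ℕ)| < η := hj
    rw [abs_lt] at hi' hj'
    rcases Nat.lt_or_gt_of_ne (Fin.val_ne_of_ne hij) with h | h
    · have : ((i : ℕ) : ℝ) + 1 ≤ (j : ℕ) := by exact_mod_cast h
      nlinarith
    · have : ((j : ℕ) : ℝ) + 1 ≤ (i : ℕ) := by exact_mod_cast h
      nlinarith
  obtain ⟨j, hj⟩ := EntropyBound.exists_real_mul_log_le hK (P := fun j => π.law (v j))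
    (fun j => π.entropyBound_law (v' := v ⟨0, hK⟩)
      fun a => entropyBound_reward hΔ.ne' hσ.ne' (hx j) (hx ⟨0, hK⟩) a) hS hdisj
  have hsucc : (π.law (v j)).real (S j) ≤ z / 2 := by
    rw [← le_div_iff₀ hlogK] at hj
    refine hj.trans (le_of_eq ?_)
    rw [hz]
    field_simp
  refine le_trans ?_ (le_iSup₂ (f := fun v _ => π.failureProb v η) (v j)
    (gaussianEnv_mem hΔ σ _ (hx j)))
  have hfail : π.failureProb (v j) η = π.law (v j) (S j)ᶜ := by
    rw [Policy.failureProb]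
    congr 1
    ext p
    simp [S]
  rw [hfail, ← ofReal_measureReal, probReal_compl_eq_one_sub (hS j)]
  exact ENNReal.ofReal_le_ofReal ((exp_neg_le_one_sub_half hz0 hz1).trans (by linarith))
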